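/- Let $d$ be a natural number and let $\|\cdot\|$ be any norm on $\mathbb{R}^d$. Balls $B(x,r)$, $r>0$, are taken with respect to this norm, and are either all open or all closed (the statement holds for each of the two choices). Let $\mu$ be a Radon measure on $(\mathbb{R}^d,\|\cdot\|)$ such that $\mu(\mathbb{R}^d)=\infty$ and $$\mu\big(\{x\in\operatorname{supp}(\mu):\ r\mapsto\mu(B(x,r))\ \text{is discontinuous on } (0,\infty)\}\big)=0 .$$ Define the uncentered Hardy–Littlewood maximal function $$M_\mu f(x)=\sup_{B\ni x,\ \mu(B)>0}\ \frac1{\mu(B)}\int_B|f|\,d\mu ,$$ the supremum being taken over all balls $B$ that contain $x$ and have positive measure. Let $H^*=H^*(\mathbb{R}^d,\|\cdot\|)$ be the strict Hadwiger number, that is, the maximum number of pairwise disjoint translates of the closed unit ball $B^{cl}(0,1)$ each of which touches $B^{cl}(0,1)$ (meets it without common interior points). Then for every $1<p<\infty$ and every real-valued $f\in L^p(\mu)$, $$\|M_\mu f\|_{L^p(\mu)}\ \ge\ \Big(1+\frac{1}{(p-1)H^*}\Big)^{1/p}\,\|f\|_{L^p(\mu)} ,$$ where the left-hand side may be $+\infty$.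 -/

import Mathlib

open MeasureTheory Metric Set
open scoped ENNReal

/-- A set `S` of centres such that each translate `closedBall c 1`, `c ∈ S`, of the closed unit ball
touches the closed unit ball (they meet, but their interiors do not), and any two of these
translates are disjoint. -/
structure IsStrictKissingSet {E : Type*} [NormedAddCommGroup E] [NormedSpace ℝ E]
    (S : Set E) : Prop where
  meets : ∀ c ∈ S, (closedBall c 1 ∩ closedBall (0 : E) 1).Nonempty
  no_overlap : ∀ c ∈ S, Disjoint (interior (closedBall c 1)) (interior (closedBall (0 : E) 1))
  pairwise_disjoint : S.PairwiseDisjoint (fun c => closedBall c 1)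

/-- The strict Hadwiger number `H*` of a normed space: the maximal number of pairwise disjoint
translates of the closed unit ball that touch the closed unit ball. It takes values in `ℕ∞`, so
that the supremum carries no convention about unbounded sets. -/
noncomputable def strictHadwigerNumber (E : Type*) [NormedAddCommGroup E] [NormedSpace ℝ E] : ℕ∞ :=
  ⨆ (S : Set E) (_ : IsStrictKissingSet S), S.encard

/-- The uncentered Hardy-Littlewood maximal function
`M_μ f (x) = sup { (1 / μ B) ∫_B |f| dμ : B a ball, x ∈ B, μ B > 0 }`, with values in `[0, ∞]`.
The argument `B` is the kind of balls in use, `Metric.ball` or `Metric.closedBall`. -/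
noncomputable def uncenteredMaximal {E : Type*} [MeasurableSpace E] (B : E → ℝ → Set E)
    (μ : Measure E) (f : E → ℝ) (x : E) : ℝ≥0∞ :=
  ⨆ (c : E) (r : ℝ) (_ : 0 < r) (_ : x ∈ B c r) (_ : 0 < μ (B c r)),
    (∫⁻ y in B c r, ‖f y‖ₑ ∂μ) / μ (B c r)

/-! Write `F = |f|`, `ρ = F μ` and fix `t > 0`. The heart is a reversed weak-type inequality: the
integral of `(F - t)⁺` is at most `t H* μ {F < t ≤ M F}`.

By differentiation, almost every `x` with `F x > t` is the centre of a ball of average at least `t`.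
As `μ` is infinite and `F` is in `L^p`, such balls have bounded measure, hence bounded radius while
the centres stay in a compact set. Spheres about almost every centre are null, so a largest radius
is attained and its average is exactly `t`. Greedy selection by decreasing radius covers the compact
set by such balls, none containing the centre of another (`exists_balls_measure_eq`). On each ball
the excess over `t` equals the deficit, hence is at most `t μ (ball ∩ {F < t})`
(`setLIntegral_sub_le`). The directions from a common point to the centres, scaled to norm 2, form a
strict kissing set, so at most `H*` balls overlap at a point (`card_le_strictHadwigerNumber`).

Since `F ≤ M F` almost everywhere, integration against `t ^ (p - 2)` gives `‖F‖^p / (p (p - 1)) ≤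
(H* / p) (‖M F‖^p - ‖F‖^p)`, which is the claim. -/

/-! ### Overlap of balls and the strict Hadwiger number -/

section Hadwiger

variable {E : Type*} [NormedAddCommGroup E] [NormedSpace ℝ E]

/-- Two vectors that are further apart than both of their norms are still more than `1` apart after
normalization. -/
theorem one_lt_norm_normalize_sub {v w : E} (hw : w ≠ 0) (h : ‖w‖ ≤ ‖v‖)
    (hvw : ‖v‖ < ‖v - w‖) : 1 < ‖‖v‖⁻¹ • v - ‖w‖⁻¹ • w‖ := by
  have hw0 : 0 < ‖w‖ := norm_pos_iff.2 hw
  have hv0 : 0 < ‖v‖ := hw0.trans_le h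
  set a := ‖v‖ with ha
  set b := ‖w‖ with hb
  have hu : ‖a⁻¹ • v‖ = 1 := by
    rw [norm_smul, norm_inv, Real.norm_of_nonneg hv0.le, ← ha, inv_mul_cancel₀ hv0.ne']
  -- Shortening `v` to norm `b` costs only `a - b`; since `a < ‖v - w‖`, more than `b` remains for
  -- the second term.
  have key : v - w = (a - b) • (a⁻¹ • v) + b • (a⁻¹ • v - b⁻¹ • w) := by
    rw [smul_sub, smul_inv_smul₀ hw0.ne', sub_smul, smul_inv_smul₀ hv0.ne']
    abel
  have hle : ‖v - w‖ ≤ (a - b) * 1 + b * ‖a⁻¹ • v - b⁻¹ • w‖ := by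
    rw [key]
    refine (norm_add_le _ _).trans ?_
    rw [norm_smul (a - b), norm_smul b, hu, Real.norm_of_nonneg (sub_nonneg.2 h),
      Real.norm_of_nonneg hw0.le]
  nlinarith

theorem isStrictKissingSet_of_norm_eq_two {S : Set E} (h2 : ∀ c ∈ S, ‖c‖ = 2)
    (hS : S.Pairwise fun c c' => 2 < ‖c - c'‖) : IsStrictKissingSet S where
  meets c hc := by
    refine ⟨(2⁻¹ : ℝ) • c, ?_, ?_⟩
    · have : (2⁻¹ : ℝ) • c - c = (-(2⁻¹ : ℝ)) • c := by module
      rw [mem_closedBall, dist_eq_norm, this, norm_smul, h2 c hc]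
      norm_num
    · rw [mem_closedBall, dist_zero_right, norm_smul, h2 c hc]
      norm_num
  no_overlap c hc := by
    rw [interior_closedBall _ one_ne_zero, interior_closedBall _ one_ne_zero]
    refine ball_disjoint_ball ?_
    rw [dist_zero_right, h2 c hc]
    norm_num
  pairwise_disjoint c hc c' hc' hne := by
    refine closedBall_disjoint_closedBall ?_
    rw [dist_eq_norm]
    linarith [hS hc hc' hne]

theorem encard_le_strictHadwigerNumber {S : Set E} (hS : IsStrictKissingSet S) :
    S.encard ≤ strictHadwigerNumber E :=
  le_iSup₂ (f := fun (S : Set E) (_ : IsStrictKissingSet S) => S.encard) S hS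

theorem one_le_strictHadwigerNumber [Nontrivial E] : 1 ≤ strictHadwigerNumber E := by
  obtain ⟨v, hv⟩ := exists_norm_eq E (zero_le_two (α := ℝ))
  rw [← Set.encard_singleton v]
  refine encard_le_strictHadwigerNumber (isStrictKissingSet_of_norm_eq_two ?_ ?_)
  · simpa using hv
  · simp

/-- Balls with a common point, none of which contains the centre of another one, are at most
as many as the strict Hadwiger number. -/
theorem card_le_strictHadwigerNumber [Nontrivial E] {ι : Type*} (s : Finset ι) (c : ι → E)
    (r : ι → ℝ) (y : E) (hy : ∀ i ∈ s, y ∈ ball (c i) (r i))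
    (hd : ∀ i ∈ s, ∀ j ∈ s, i ≠ j → r i ≤ dist (c i) (c j)) :
    (s.card : ℕ∞) ≤ strictHadwigerNumber E := by
  -- With two or more balls no centre equals `y`, so the vectors `c i - y` can be normalized.
  rcases le_or_gt s.card 1 with hs | hs
  · exact (by exact_mod_cast hs : (s.card : ℕ∞) ≤ 1).trans one_le_strictHadwigerNumber
  set v : ι → E := fun i => c i - y with hv
  have hlt : ∀ i ∈ s, ∀ j ∈ s, i ≠ j → ‖v i‖ < ‖v i - v j‖ := by
    intro i hi j hj hij
    have h1 := hy i hi
    rw [mem_ball', dist_eq_norm] at h1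
    have h2 := hd i hi j hj hij
    rw [dist_eq_norm] at h2
    have : v i - v j = c i - c j := by simp [hv]
    rw [this]
    exact h1.trans_le h2
  have hne : ∀ i ∈ s, v i ≠ 0 := by
    intro i hi h0
    obtain ⟨j, hj, hji⟩ := Finset.exists_mem_ne hs i
    have := hlt j hj i hi hji
    simp [h0] at this
  set w : ι → E := fun i => (2 : ℝ) • (‖v i‖⁻¹ • v i) with hw
  have hsep : ∀ i ∈ s, ∀ j ∈ s, i ≠ j → 2 < ‖w i - w j‖ := by
    intro i hi j hj hij
    have : 1 < ‖‖v i‖⁻¹ • v i - ‖v j‖⁻¹ • v j‖ := by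
      rcases le_total ‖v j‖ ‖v i‖ with h | h
      · exact one_lt_norm_normalize_sub (hne j hj) h (hlt i hi j hj hij)
      · rw [norm_sub_rev]
        exact one_lt_norm_normalize_sub (hne i hi) h (hlt j hj i hi hij.symm)
    simp only [hw]
    rw [← smul_sub, norm_smul, Real.norm_of_nonneg zero_le_two]
    linarith
  have hinj : Set.InjOn w s := by
    intro i hi j hj hij
    by_contra hne'
    have := hsep i hi j hj hne'
    simp only [hij, sub_self, norm_zero] at this
    linarith
  have hS : IsStrictKissingSet (w '' s) := by
    refine isStrictKissingSet_of_norm_eq_two ?_ ?_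
    · rintro _ ⟨i, hi, rfl⟩
      simp only [hw]
      rw [norm_smul, norm_smul, norm_inv, norm_norm,
        inv_mul_cancel₀ (norm_ne_zero_iff.2 (hne i hi))]
      norm_num
    · rintro _ ⟨i, hi, rfl⟩ _ ⟨j, hj, rfl⟩ hij
      exact hsep i hi j hj fun h => hij (by rw [h])
  have := encard_le_strictHadwigerNumber hS
  rwa [hinj.encard_image, Set.encard_coe_eq_coe_finsetCard] at this

end Hadwiger

/-! ### Greedy covering -/

/-- Greedy selection of balls by decreasing radius, when the maximal radius is attained on each
compact set of centres. -/
theorem exists_greedy_balls {X : Type*} [MetricSpace X] {K : Set X} (hK : IsCompact K)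
    (T : Set (X × ℝ)) (hT : ∀ q ∈ T, 0 < q.2)
    (hmax : ∀ K' ⊆ K, IsCompact K' → K'.Nonempty →
      ∃ q ∈ T, q.1 ∈ K' ∧ ∀ q' ∈ T, q'.1 ∈ K' → q'.2 ≤ q.2)
    (hcov : ∀ x ∈ K, ∃ s, (x, s) ∈ T) (x₀ : X) :
    ∃ (c : ℕ → X) (r : ℕ → ℝ),
      (∀ n, r n = 0 ∨ (0 < r n ∧ c n ∈ K ∧ (c n, r n) ∈ T ∧ ∀ s, (c n, s) ∈ T → s ≤ r n)) ∧
      K ⊆ ⋃ n, ball (c n) (r n) ∧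
      ∀ i j, i ≠ j → 0 < r i → 0 < r j → r i ≤ dist (c i) (c j) := by
  have hsel : ∀ K' : Set X, ∃ q : X × ℝ, (K' ⊆ K → IsCompact K' →
      (K' = ∅ ∧ q.2 = 0) ∨ (q ∈ T ∧ q.1 ∈ K' ∧ ∀ q' ∈ T, q'.1 ∈ K' → q'.2 ≤ q.2)) := by
    intro K'
    by_cases h : K' ⊆ K ∧ IsCompact K' ∧ K'.Nonempty
    · obtain ⟨q, hq⟩ := hmax K' h.1 h.2.1 h.2.2
      exact ⟨q, fun _ _ => Or.inr hq⟩
    -- The dummy radius `0` gives an empty ball and marks that nothing is left to cover.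
    · refine ⟨(x₀, 0), fun h1 h2 => Or.inl ⟨?_, rfl⟩⟩
      by_contra h3
      exact h ⟨h1, h2, nonempty_iff_ne_empty.2 h3⟩
  choose q hq using hsel
  -- `A n` is what the first `n` balls leave uncovered, compact because open balls are removed.
  let A : ℕ → Set X := fun n => Nat.rec K (fun _ K' => K' \ ball (q K').1 (q K').2) n
  have hA0 : A 0 = K := rfl
  have hAs : ∀ n, A (n + 1) = A n \ ball (q (A n)).1 (q (A n)).2 := fun n => rfl
  have hanti : Antitone A := antitone_nat_of_succ_le fun n => by
    rw [hAs]
    exact sdiff_subset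
  have hsub : ∀ n, A n ⊆ K := fun n => hanti (Nat.zero_le n)
  have hcomp : ∀ n, IsCompact (A n) := by
    intro n
    induction n with
    | zero => exact hK
    | succ n ih => rw [hAs]; exact ih.diff isOpen_ball
  have hQ := fun n => hq (A n) (hsub n) (hcomp n)
  have hfwd : ∀ i j, i < j → 0 < (q (A j)).2 →
      (q (A i)).2 ≤ dist (q (A i)).1 (q (A j)).1 ∧ (q (A j)).2 ≤ (q (A i)).2 := by
    intro i j hij hj
    rcases hQ j with h | ⟨hjT, hjA, -⟩
    · exact absurd h.2 hj.ne'
    have hmem := hanti (Nat.succ_le_of_lt hij) hjA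
    rw [Nat.succ_eq_add_one, hAs] at hmem
    rcases hQ i with h | ⟨-, -, him⟩
    · rw [h.1] at hmem
      exact absurd hmem.1 (notMem_empty _)
    · refine ⟨?_, him _ hjT hmem.1⟩
      have := hmem.2
      rwa [mem_ball', not_lt] at this
  refine ⟨fun n => (q (A n)).1, fun n => (q (A n)).2, ?_, ?_, ?_⟩
  · intro n
    rcases hQ n with h | ⟨h1, h2, h3⟩
    · exact Or.inl h.2
    · exact Or.inr ⟨hT _ h1, hsub n h2, h1, fun s hs => h3 _ hs h2⟩
  · intro x hx
    by_contra hnot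
    -- A point never covered keeps all radii at least `s`; the centres would be `s`-separated in the
    -- compact set `K`, against a convergent subsequence.
    have hxA : ∀ n, x ∈ A n := by
      intro n
      induction n with
      | zero => exact hx
      | succ n ih =>
        rw [hAs]
        exact ⟨ih, fun h => hnot (mem_iUnion.2 ⟨n, h⟩)⟩
    obtain ⟨s, hs⟩ := hcov x hx
    have hspos : 0 < s := hT _ hs
    have hge : ∀ n, s ≤ (q (A n)).2 ∧ (q (A n)).1 ∈ K := by
      intro n
      rcases hQ n with h | ⟨-, h2, h3⟩
      · have := hxA n
        rw [h.1] at this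
        exact absurd this (notMem_empty _)
      · exact ⟨h3 _ hs (hxA n), hsub n h2⟩
    obtain ⟨a, -, φ, hφ, hlim⟩ := hK.tendsto_subseq fun n => (hge n).2
    obtain ⟨N, hN⟩ := Metric.cauchySeq_iff'.1 hlim.cauchySeq s hspos
    have h1 := hN (N + 1) (Nat.le_succ N)
    have h2 := (hfwd (φ N) (φ (N + 1)) (hφ (Nat.lt_succ_self N))
      (hspos.trans_le (hge _).1)).1
    rw [dist_comm] at h1
    exact absurd h1 (not_lt.2 ((hge _).1.trans h2))
  · intro i j hij hi hj
    rcases lt_or_gt_of_ne hij with h | h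
    · exact (hfwd i j h hj).1
    · rw [dist_comm]
      exact (hfwd j i h hi).2.trans (hfwd j i h hi).1

open Filter Topology

/-! ### Null spheres and maximal radii -/

section Radii

variable {X : Type*} [MetricSpace X] [MeasurableSpace X]

theorem tendsto_measure_ball_sub (μ : Measure X) (x : X) (r : ℝ) :
    Tendsto (fun n : ℕ => μ (ball x (r - 1 / ((n : ℝ) + 1)))) atTop (𝓝 (μ (ball x r))) := by
  have hU : ball x r = ⋃ n : ℕ, ball x (r - 1 / ((n : ℝ) + 1)) := by
    ext y
    simp only [mem_ball, mem_iUnion]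
    constructor
    · intro h
      obtain ⟨n, hn⟩ := exists_nat_one_div_lt (sub_pos.2 h)
      exact ⟨n, by linarith⟩
    · rintro ⟨n, hn⟩
      have : 0 < 1 / ((n : ℝ) + 1) := Nat.one_div_pos_of_nat
      linarith
  rw [hU]
  refine tendsto_measure_iUnion_atTop fun m n hmn => ball_subset_ball ?_
  have := Nat.one_div_le_one_div (α := ℝ) hmn
  linarith

theorem measure_closedBall_eq_measure_ball {μ : Measure X} {x : X} {r : ℝ}
    (h : μ (sphere x r) = 0) : μ (closedBall x r) = μ (ball x r) := by
  rw [← ball_union_sphere]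
  exact measure_congr (union_ae_eq_left_of_ae_eq_empty (ae_eq_empty.2 h))

variable [OpensMeasurableSpace X] [ProperSpace X]

theorem tendsto_measure_closedBall_add (μ : Measure X) [IsFiniteMeasureOnCompacts μ] (x : X)
    (r : ℝ) :
    Tendsto (fun n : ℕ => μ (closedBall x (r + 1 / ((n : ℝ) + 1)))) atTop
      (𝓝 (μ (closedBall x r))) := by
  have hU : closedBall x r = ⋂ n : ℕ, closedBall x (r + 1 / ((n : ℝ) + 1)) := by
    ext y
    simp only [mem_closedBall, mem_iInter]
    constructor
    · intro h n
      have : 0 < 1 / ((n : ℝ) + 1) := Nat.one_div_pos_of_nat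
      linarith
    · intro h
      refine le_of_forall_pos_le_add fun ε hε => ?_
      obtain ⟨n, hn⟩ := exists_nat_one_div_lt hε
      linarith [h n]
  rw [hU]
  refine tendsto_measure_iInter_atTop
    (fun n => isClosed_closedBall.measurableSet.nullMeasurableSet)
    (fun m n hmn => closedBall_subset_closedBall ?_) ⟨0, (isCompact_closedBall _ _).measure_ne_top⟩
  have := Nat.one_div_le_one_div (α := ℝ) hmn
  linarith

theorem measure_sphere_eq_zero_of_le {μ : Measure X} [IsFiniteMeasureOnCompacts μ] {x : X} {r : ℝ}
    (h : μ (closedBall x r) ≤ μ (ball x r)) : μ (sphere x r) = 0 := by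
  have h1 : sphere x r = closedBall x r \ ball x r := by
    ext y
    simp only [mem_sphere, Set.mem_sdiff, mem_closedBall, mem_ball, not_lt]
    exact le_antisymm_iff
  have hfin : μ (ball x r) ≠ ∞ :=
    ((measure_mono ball_subset_closedBall).trans_lt
      (isCompact_closedBall x r).measure_lt_top).ne
  rw [h1, measure_sdiff ball_subset_closedBall measurableSet_ball.nullMeasurableSet hfin]
  exact tsub_eq_zero_of_le h

/-- One-sided limits suffice: open balls of larger radius contain `closedBall x r`, and closed balls
of smaller radius lie in `ball x r`. -/
theorem measure_sphere_eq_zero_of_continuousOn {B : X → ℝ → Set X}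
    (hB : B = Metric.ball ∨ B = Metric.closedBall) {μ : Measure X} [IsFiniteMeasureOnCompacts μ]
    {x : X} (hc : ContinuousOn (fun r : ℝ => μ (B x r)) (Ioi 0)) {r : ℝ} (hr : 0 < r) :
    μ (sphere x r) = 0 := by
  apply measure_sphere_eq_zero_of_le
  have hcr : ContinuousAt (fun r : ℝ => μ (B x r)) r := hc.continuousAt (Ioi_mem_nhds hr)
  rcases hB with rfl | rfl
  · refine ge_of_tendsto (hcr.tendsto.mono_left (nhdsWithin_le_nhds (s := Ioi r))) ?_
    filter_upwards [self_mem_nhdsWithin] with s hs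
    exact measure_mono (closedBall_subset_ball hs)
  · refine le_of_tendsto (hcr.tendsto.mono_left (nhdsWithin_le_nhds (s := Iio r))) ?_
    filter_upwards [self_mem_nhdsWithin] with s hs
    exact measure_mono (closedBall_subset_ball hs)

/-- The comparison `t μ ≤ ρ` passes to limits of balls. -/
theorem mul_measure_ball_le_of_tendsto {μ ρ : Measure X} [IsFiniteMeasureOnCompacts ρ] {x : X}
    {r : ℝ} (hρ : ρ (sphere x r) = 0) {t : ℝ≥0∞} (ht : t ≠ ∞) {y : ℕ → X} {s : ℕ → ℝ}
    (hy : Tendsto y atTop (𝓝 x)) (hs : Tendsto s atTop (𝓝 r))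
    (h : ∀ n, t * μ (ball (y n) (s n)) ≤ ρ (ball (y n) (s n))) :
    t * μ (ball x r) ≤ ρ (ball x r) := by
  -- A nearby ball `ball (y m) (s m)` fits between `ball x (r - ε)` and `closedBall x (r + ε)`; the
  -- null sphere absorbs the closed ball in the limit.
  rw [← measure_closedBall_eq_measure_ball hρ]
  refine le_of_tendsto_of_tendsto'
    (ENNReal.Tendsto.const_mul (tendsto_measure_ball_sub μ x r) (Or.inr ht))
    (tendsto_measure_closedBall_add ρ x r) fun n => ?_
  have hε : 0 < 1 / ((n : ℝ) + 1) := Nat.one_div_pos_of_nat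
  set ε := 1 / ((n : ℝ) + 1)
  obtain ⟨m, hm1, hm2⟩ := ((Metric.tendsto_nhds.1 hy (ε / 2) (half_pos hε)).and
    (Metric.tendsto_nhds.1 hs (ε / 2) (half_pos hε))).exists
  rw [Real.dist_eq, abs_lt] at hm2
  calc t * μ (ball x (r - ε)) ≤ t * μ (ball (y m) (s m)) := by
        gcongr
        refine ball_subset_ball' ?_
        rw [dist_comm]
        linarith
    _ ≤ ρ (ball (y m) (s m)) := h m
    _ ≤ ρ (closedBall x (r + ε)) :=
        measure_mono (ball_subset_closedBall.trans (closedBall_subset_closedBall' (by linarith)))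

/-- At a maximal radius with `t μ ≤ ρ` one has `ρ ≤ t μ`. -/
theorem measure_ball_le_mul_of_forall_gt {μ ρ : Measure X} [IsFiniteMeasureOnCompacts μ] {x : X}
    {r : ℝ} (hμ : μ (sphere x r) = 0) {t : ℝ≥0∞} (ht : t ≠ ∞)
    (h : ∀ s > r, ρ (ball x s) ≤ t * μ (ball x s)) : ρ (ball x r) ≤ t * μ (ball x r) := by
  rw [← measure_closedBall_eq_measure_ball hμ]
  refine ge_of_tendsto'
    (ENNReal.Tendsto.const_mul (tendsto_measure_closedBall_add μ x r) (Or.inr ht)) fun n => ?_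
  have hε : 0 < 1 / ((n : ℝ) + 1) := Nat.one_div_pos_of_nat
  calc ρ (ball x r) ≤ ρ (ball x (r + 1 / ((n : ℝ) + 1))) :=
        measure_mono (ball_subset_ball (by linarith))
    _ ≤ t * μ (ball x (r + 1 / ((n : ℝ) + 1))) := h _ (by linarith)
    _ ≤ _ := by gcongr; exact ball_subset_closedBall

/-- A compact set of centres of balls with `t μ ≤ ρ` is covered by balls with `ρ = t μ`, none of
which contains the centre of another one. -/
theorem exists_balls_measure_eq {μ ρ : Measure X} [IsFiniteMeasureOnCompacts μ]
    [IsFiniteMeasureOnCompacts ρ] {K : Set X} (hK : IsCompact K)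
    (hμ : ∀ x ∈ K, ∀ r > 0, μ (sphere x r) = 0) (hρ : ∀ x ∈ K, ∀ r > 0, ρ (sphere x r) = 0)
    {t : ℝ≥0∞} (ht : t ≠ ∞) (hcov : ∀ x ∈ K, ∃ s > 0, t * μ (ball x s) ≤ ρ (ball x s))
    {R : ℝ} (hR : ∀ x ∈ K, ∀ s > 0, t * μ (ball x s) ≤ ρ (ball x s) → s ≤ R) (x₀ : X) :
    ∃ (c : ℕ → X) (r : ℕ → ℝ),
      (∀ n, r n = 0 ∨ (0 < r n ∧ c n ∈ K ∧
        ρ (ball (c n) (r n)) = t * μ (ball (c n) (r n)))) ∧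
      K ⊆ ⋃ n, ball (c n) (r n) ∧
      ∀ i j, i ≠ j → 0 < r i → 0 < r j → r i ≤ dist (c i) (c j) := by
  set T : Set (X × ℝ) := {q | 0 < q.2 ∧ t * μ (ball q.1 q.2) ≤ ρ (ball q.1 q.2)}
  suffices hmax : ∀ K' ⊆ K, IsCompact K' → K'.Nonempty →
      ∃ q ∈ T, q.1 ∈ K' ∧ ∀ q' ∈ T, q'.1 ∈ K' → q'.2 ≤ q.2 by
    obtain ⟨c, r, h1, h2, h3⟩ := exists_greedy_balls hK T (fun q hq => hq.1) hmax hcov x₀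
    refine ⟨c, r, fun n => (h1 n).imp_right ?_, h2, h3⟩
    rintro ⟨hr, hc, hT, hm⟩
    refine ⟨hr, hc, le_antisymm ?_ hT.2⟩
    refine measure_ball_le_mul_of_forall_gt (hμ _ hc _ hr) ht fun s hs => ?_
    by_contra hlt
    exact absurd (hm s ⟨hr.trans hs, (not_le.1 hlt).le⟩) (not_le.2 hs)
  intro K' hK'K hK' ⟨x, hx⟩
  obtain ⟨δ, hδ, hδ'⟩ := hcov x (hK'K hx)
  -- Cutting off below one admissible radius `δ` gives compactness and loses no candidate for the
  -- maximum.
  set T' : Set (X × ℝ) := (K' ×ˢ Icc δ R) ∩ {q | t * μ (ball q.1 q.2) ≤ ρ (ball q.1 q.2)}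
    with hT'
  have hclosed : IsClosed T' := by
    refine IsSeqClosed.isClosed fun u q hu hq => ?_
    have hq1 : q ∈ K' ×ˢ Icc δ R :=
      (hK'.isClosed.prod isClosed_Icc).mem_of_tendsto hq (Eventually.of_forall fun n => (hu n).1)
    refine ⟨hq1, ?_⟩
    exact mul_measure_ball_le_of_tendsto (hρ _ (hK'K hq1.1) _ (hδ.trans_le hq1.2.1)) ht
      ((continuous_fst.tendsto q).comp hq) ((continuous_snd.tendsto q).comp hq)
      fun n => (hu n).2
  have hcompact : IsCompact T' :=
    (hK'.prod isCompact_Icc).of_isClosed_subset hclosed inter_subset_left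
  have hne : T'.Nonempty := ⟨(x, δ), ⟨hx, le_refl δ, hR x (hK'K hx) δ hδ hδ'⟩, hδ'⟩
  obtain ⟨q, hq, hqm⟩ := hcompact.exists_isMaxOn hne continuous_snd.continuousOn
  have hqδ : δ ≤ q.2 := hq.1.2.1
  refine ⟨q, ⟨hδ.trans_le hqδ, hq.2⟩, hq.1.1, fun q' hq' hq'K => ?_⟩
  rcases le_total q'.2 δ with h | h
  · exact h.trans hqδ
  · exact hqm (show q' ∈ T' from ⟨⟨hq'K, h, hR _ (hK'K hq'K) _ hq'.1 hq'.2⟩, hq'.2⟩)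

end Radii

/-! ### A measurable minorant of the maximal function -/

/-- Maximal function of `ρ` with respect to `μ` over the open balls with `μ`-null sphere. -/
noncomputable def openMaximal {X : Type*} [MetricSpace X] [MeasurableSpace X] (μ ρ : Measure X)
    (x : X) : ℝ≥0∞ :=
  ⨆ (c : X) (r : ℝ) (_ : 0 < r) (_ : 0 < μ (ball c r)) (_ : μ (sphere c r) = 0),
    (ball c r).indicator (fun _ => ρ (ball c r) / μ (ball c r)) x

section OpenMaximal

variable {X : Type*} [MetricSpace X] [MeasurableSpace X]

theorem measurable_openMaximal [BorelSpace X] (μ ρ : Measure X) :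
    Measurable (openMaximal μ ρ) := by
  refine LowerSemicontinuous.measurable ?_
  unfold openMaximal
  refine lowerSemicontinuous_iSup fun c => lowerSemicontinuous_iSup fun r =>
    lowerSemicontinuous_iSup fun _ => lowerSemicontinuous_iSup fun _ =>
    lowerSemicontinuous_iSup fun _ => ?_
  exact isOpen_ball.lowerSemicontinuous_indicator zero_le

theorem le_openMaximal {μ ρ : Measure X} {c x : X} {r : ℝ} (hr : 0 < r) (hx : x ∈ ball c r)
    (hpos : 0 < μ (ball c r)) (hfin : μ (ball c r) ≠ ∞) (hs : μ (sphere c r) = 0) {t : ℝ≥0∞}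
    (h : t * μ (ball c r) ≤ ρ (ball c r)) : t ≤ openMaximal μ ρ x := by
  have h1 : t ≤ (ball c r).indicator (fun _ => ρ (ball c r) / μ (ball c r)) x := by
    rw [indicator_of_mem hx]
    exact (ENNReal.le_div_iff_mul_le (Or.inl hpos.ne') (Or.inl hfin)).2 h
  refine h1.trans ?_
  unfold openMaximal
  exact le_iSup_of_le c <| le_iSup_of_le r <| le_iSup_of_le hr <| le_iSup_of_le hpos <|
    le_iSup_of_le hs le_rfl

/-- Null spheres make open and closed averages agree, so one minorant serves both kinds of balls. -/
theorem openMaximal_le_uncenteredMaximal {E : Type*} [NormedAddCommGroup E] [MeasurableSpace E]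
    {B : E → ℝ → Set E} (hB : B = Metric.ball ∨ B = Metric.closedBall) (μ : Measure E) [SFinite μ]
    (f : E → ℝ) (x : E) :
    openMaximal μ (μ.withDensity fun y => ‖f y‖ₑ) x ≤ uncenteredMaximal B μ f x := by
  unfold openMaximal
  refine iSup_le fun c => iSup_le fun r => iSup_le fun hr => iSup_le fun hpos => iSup_le fun hs => ?_
  by_cases hx : x ∈ ball c r
  · rw [indicator_of_mem hx, withDensity_apply']
    have hae : B c r =ᵐ[μ] ball c r := by
      rcases hB with rfl | rfl
      · exact ae_eq_rfl
      · rw [← ball_union_sphere]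
        exact union_ae_eq_left_of_ae_eq_empty (ae_eq_empty.2 hs)
    have hxB : x ∈ B c r := by
      rcases hB with rfl | rfl
      · exact hx
      · exact ball_subset_closedBall hx
    have hposB : 0 < μ (B c r) := by rwa [measure_congr hae]
    rw [← measure_congr hae, ← setLIntegral_congr hae]
    unfold uncenteredMaximal
    exact le_iSup_of_le c <| le_iSup_of_le r <| le_iSup_of_le hr <| le_iSup_of_le hxB <|
      le_iSup_of_le hposB le_rfl
  · rw [indicator_of_notMem hx]
    exact zero_le

end OpenMaximal

/-! ### Estimates on averages and on overlapping sets -/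

section Bounds

variable {X : Type*} [MeasurableSpace X]

/-- Where `a ≥ t / 2`, the factor `(a / (t / 2)) ^ (p - 1)` is at least `1`. -/
theorem ofReal_le_half_add {p t a : ℝ} (hp : 1 < p) (ht : 0 < t) (ha : 0 ≤ a) :
    ENNReal.ofReal a ≤
      ENNReal.ofReal (t / 2) + ENNReal.ofReal ((t / 2) ^ (1 - p)) * ENNReal.ofReal (a ^ p) := by
  have ht2 : 0 < t / 2 := half_pos ht
  rw [← ENNReal.ofReal_mul (by positivity), ← ENNReal.ofReal_add ht2.le (by positivity)]
  apply ENNReal.ofReal_le_ofReal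
  rcases le_total a (t / 2) with h | h
  · have : 0 ≤ (t / 2) ^ (1 - p) * a ^ p := by positivity
    linarith
  · have ha0 : 0 < a := ht2.trans_le h
    have h1 : a ^ (1 - p) ≤ (t / 2) ^ (1 - p) :=
      Real.rpow_le_rpow_of_nonpos ht2 h (by linarith)
    have h2 : a ^ (1 - p) * a ^ p = a := by
      rw [← Real.rpow_add ha0, sub_add_cancel, Real.rpow_one]
    have h3 : a ^ (1 - p) * a ^ p ≤ (t / 2) ^ (1 - p) * a ^ p := by gcongr
    linarith

theorem exists_withDensity_le {μ : Measure X} {φ : X → ℝ} (hφ : 0 ≤ φ) {p : ℝ} (hp : 1 < p)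
    (hint : ∫⁻ x, ENNReal.ofReal (φ x ^ p) ∂μ ≠ ∞) {t : ℝ} (ht : 0 < t) :
    ∃ C : ℝ≥0∞, C ≠ ∞ ∧ ∀ s, MeasurableSet s →
      μ.withDensity (fun x => ENNReal.ofReal (φ x)) s ≤ ENNReal.ofReal (t / 2) * μ s + C := by
  refine ⟨ENNReal.ofReal ((t / 2) ^ (1 - p)) * ∫⁻ x, ENNReal.ofReal (φ x ^ p) ∂μ,
    ENNReal.mul_ne_top ENNReal.ofReal_ne_top hint, fun s hs => ?_⟩
  rw [withDensity_apply _ hs]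
  calc ∫⁻ x in s, ENNReal.ofReal (φ x) ∂μ
      ≤ ∫⁻ x in s, ENNReal.ofReal (t / 2) +
          ENNReal.ofReal ((t / 2) ^ (1 - p)) * ENNReal.ofReal (φ x ^ p) ∂μ :=
        lintegral_mono fun x => ofReal_le_half_add hp ht (hφ x)
    _ = ENNReal.ofReal (t / 2) * μ s +
          ENNReal.ofReal ((t / 2) ^ (1 - p)) * ∫⁻ x in s, ENNReal.ofReal (φ x ^ p) ∂μ := by
        rw [lintegral_add_left measurable_const, setLIntegral_const,
          lintegral_const_mul' _ _ ENNReal.ofReal_ne_top]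
    _ ≤ _ := by gcongr; exact Measure.restrict_le_self

/-- The bound `(t / 2) μ s + C` absorbs only half of `t μ s`; finiteness of `μ s` permits the
subtraction. -/
theorem exists_measure_bound {μ : Measure X} {φ : X → ℝ} (hφ : 0 ≤ φ) {p : ℝ} (hp : 1 < p)
    (hint : ∫⁻ x, ENNReal.ofReal (φ x ^ p) ∂μ ≠ ∞) {t : ℝ} (ht : 0 < t) :
    ∃ C : ℝ≥0∞, C ≠ ∞ ∧ ∀ s, MeasurableSet s → μ s ≠ ∞ →
      ENNReal.ofReal t * μ s ≤ μ.withDensity (fun x => ENNReal.ofReal (φ x)) s → μ s ≤ C := by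
  obtain ⟨C, hC, h⟩ := exists_withDensity_le hφ hp hint ht
  refine ⟨C / ENNReal.ofReal (t / 2),
    ENNReal.div_ne_top hC (ENNReal.ofReal_pos.2 (half_pos ht)).ne', fun s hs hfin hle => ?_⟩
  rw [ENNReal.le_div_iff_mul_le (Or.inl (ENNReal.ofReal_pos.2 (half_pos ht)).ne')
    (Or.inl ENNReal.ofReal_ne_top)]
  have h1 := hle.trans (h s hs)
  have h2 : ENNReal.ofReal t = ENNReal.ofReal (t / 2) + ENNReal.ofReal (t / 2) := by
    rw [← ENNReal.ofReal_add (half_pos ht).le (half_pos ht).le, add_halves]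
  rw [h2, add_mul] at h1
  rw [mul_comm]
  exact (ENNReal.add_le_add_iff_left (ENNReal.mul_ne_top ENNReal.ofReal_ne_top hfin)).1 h1

/-- If the average of `F` over `s` is at most `t`, the excess of `F` over `t` is controlled by the
part of `s` on which `F < t`. -/
theorem setLIntegral_sub_le {μ : Measure X} {F : X → ℝ≥0∞} (hF : Measurable F) {t : ℝ≥0∞}
    (ht : t ≠ ∞) {s : Set X} (hfin : μ s ≠ ∞)
    (h : ∫⁻ x in s, F x ∂μ ≤ t * μ s) :
    ∫⁻ x in s, (F x - t) ∂μ ≤ t * μ (s ∩ {x | F x < t}) := by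
  have hm : MeasurableSet {x | t ≤ F x} := measurableSet_le measurable_const hF
  have hcompl : s \ {x | t ≤ F x} = s ∩ {x | F x < t} := by
    ext x
    simp
  have h1 : ∫⁻ x in s, (F x - t) ∂μ + t * μ (s ∩ {x | t ≤ F x}) ≤ ∫⁻ x in s, F x ∂μ := by
    rw [inter_comm, ← Measure.restrict_apply hm, ← lintegral_indicator_const hm,
      ← lintegral_add_left (hF.sub_const t)]
    refine lintegral_mono fun x => ?_
    by_cases hx : t ≤ F x
    · rw [indicator_of_mem (show x ∈ {x | t ≤ F x} from hx), tsub_add_cancel_of_le hx]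
    · rw [indicator_of_notMem (show x ∉ {x | t ≤ F x} from hx), add_zero]
      exact tsub_le_self
  have h2 : t * μ s = t * μ (s ∩ {x | F x < t}) + t * μ (s ∩ {x | t ≤ F x}) := by
    rw [← mul_add, ← hcompl, add_comm, measure_inter_add_sdiff _ hm]
  have hf : t * μ (s ∩ {x | t ≤ F x}) ≠ ∞ :=
    ENNReal.mul_ne_top ht ((measure_mono inter_subset_left).trans_lt hfin.lt_top).ne
  exact (ENNReal.add_le_add_iff_right hf).1 ((h1.trans h).trans_eq h2)

/-- The sum of the indicators counts the overlap, so it is at most `L` on the union; integrate. -/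
theorem tsum_measure_le_of_card_le {μ : Measure X} {A : ℕ → Set X} (hA : ∀ n, MeasurableSet (A n))
    {S : Set X} (hS : ∀ n, A n ⊆ S) {L : ℝ≥0∞}
    (hL : ∀ y, ∀ s : Finset ℕ, (∀ i ∈ s, y ∈ A i) → (s.card : ℝ≥0∞) ≤ L) :
    ∑' n, μ (A n) ≤ L * μ S := by
  classical
  have hU : MeasurableSet (⋃ n, A n) := MeasurableSet.iUnion hA
  calc ∑' n, μ (A n) = ∑' n, ∫⁻ x, (A n).indicator (fun _ => 1) x ∂μ := by
        refine tsum_congr fun n => ?_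
        rw [lintegral_indicator_const (hA n), one_mul]
    _ = ∫⁻ x, ∑' n, (A n).indicator (fun _ => 1) x ∂μ :=
        (lintegral_tsum fun n => (measurable_const.indicator (hA n)).aemeasurable).symm
    _ ≤ ∫⁻ x, (⋃ n, A n).indicator (fun _ => L) x ∂μ := by
        refine lintegral_mono fun x => ?_
        by_cases hx : x ∈ ⋃ n, A n
        · rw [indicator_of_mem hx, ENNReal.tsum_eq_iSup_sum]
          refine iSup_le fun s => ?_
          simp only [indicator_apply]
          rw [Finset.sum_boole]
          exact hL x _ fun i hi => (Finset.mem_filter.1 hi).2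
        · rw [indicator_of_notMem hx]
          simp only [mem_iUnion, not_exists] at hx
          simp [indicator_of_notMem (hx _)]
    _ = L * μ (⋃ n, A n) := lintegral_indicator_const hU L
    _ ≤ L * μ S := by gcongr; exact iUnion_subset hS

end Bounds

/-! ### The level-set inequality on compact sets -/

section LevelSets

variable {E : Type*} [NormedAddCommGroup E] [NormedSpace ℝ E] [FiniteDimensional ℝ E]
  [Nontrivial E] [MeasurableSpace E] [BorelSpace E]

theorem setLIntegral_sub_le_strictHadwigerNumber_mul {μ : Measure E} [IsFiniteMeasureOnCompacts μ]
    {F : E → ℝ≥0∞} (hF : Measurable F) [IsFiniteMeasureOnCompacts (μ.withDensity F)] {K : Set E}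
    (hK : IsCompact K) (hsupp : K ⊆ μ.support) (hμ : ∀ x ∈ K, ∀ r > 0, μ (sphere x r) = 0)
    {t : ℝ≥0∞} (ht : t ≠ ∞)
    (hcov : ∀ x ∈ K, ∃ s > 0, t * μ (ball x s) ≤ μ.withDensity F (ball x s)) {R : ℝ}
    (hR : ∀ x ∈ K, ∀ s > 0, t * μ (ball x s) ≤ μ.withDensity F (ball x s) → s ≤ R) :
    ∫⁻ x in K, (F x - t) ∂μ ≤ t * ((strictHadwigerNumber E : ℝ≥0∞) *
      μ {x | F x < t ∧ t ≤ openMaximal μ (μ.withDensity F) x}) := by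
  have : ProperSpace E := FiniteDimensional.proper_real E
  set ρ := μ.withDensity F with hρdef
  have hρ : ∀ x ∈ K, ∀ r > 0, ρ (sphere x r) = 0 := fun x hx r hr =>
    withDensity_absolutelyContinuous μ F (hμ x hx r hr)
  obtain ⟨c, r, h1, h2, h3⟩ := exists_balls_measure_eq hK hμ hρ ht hcov hR 0
  have hfin : ∀ n, μ (ball (c n) (r n)) ≠ ∞ := fun n => measure_ball_lt_top.ne
  calc ∫⁻ x in K, (F x - t) ∂μ ≤ ∫⁻ x in ⋃ n, ball (c n) (r n), (F x - t) ∂μ :=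
        lintegral_mono_set h2
    _ ≤ ∑' n, ∫⁻ x in ball (c n) (r n), (F x - t) ∂μ := lintegral_iUnion_le _ _
    _ ≤ ∑' n, t * μ (ball (c n) (r n) ∩ {x | F x < t}) := by
        refine ENNReal.tsum_le_tsum fun n => setLIntegral_sub_le hF ht (hfin n) ?_
        -- Radius `0` only pads the sequence: that ball is empty.
        rcases h1 n with h | ⟨-, -, h⟩
        · simp [h]
        · rw [← withDensity_apply _ measurableSet_ball]
          exact h.le
    _ = t * ∑' n, μ (ball (c n) (r n) ∩ {x | F x < t}) := ENNReal.tsum_mul_left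
    _ ≤ _ := by
        gcongr
        refine tsum_measure_le_of_card_le
          (fun n => measurableSet_ball.inter (measurableSet_lt hF measurable_const)) ?_ ?_
        · rintro n x ⟨hx, hxt⟩
          refine ⟨hxt, ?_⟩
          rcases h1 n with h | ⟨hr, hc, h⟩
          · simp [h] at hx
          · exact le_openMaximal hr hx
              ((Measure.mem_support_iff_forall _).1 (hsupp hc) _ (ball_mem_nhds _ hr)) (hfin n)
              (hμ _ hc _ hr) h.ge
        · intro y s hs
          have hpos : ∀ i ∈ s, 0 < r i := fun i hi => pos_of_mem_ball (hs i hi).1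
          have := card_le_strictHadwigerNumber s c r y (fun i hi => (hs i hi).1)
            fun i hi j hj hij => h3 i j hij (hpos i hi) (hpos j hj)
          exact_mod_cast ENat.toENNReal_le.2 this

end LevelSets

/-- Some `ball 0 N` has measure above `C`, and a ball centred in `K` of radius above `N + D`
contains it. -/
theorem exists_radius_bound {E : Type*} [NormedAddCommGroup E] [MeasurableSpace E]
    {μ : Measure E} (hμ : μ univ = ∞) {C : ℝ≥0∞} (hC : C ≠ ∞) {K : Set E}
    (hK : Bornology.IsBounded K) : ∃ R : ℝ, ∀ x ∈ K, ∀ s, μ (ball x s) ≤ C → s ≤ R := by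
  obtain ⟨N, hN⟩ : ∃ N : ℕ, C < μ (ball (0 : E) N) := by
    by_contra! h
    have hlim := tendsto_measure_iUnion_atTop (μ := μ) (s := fun n : ℕ => ball (0 : E) n)
      fun m n hmn => ball_subset_ball (by exact_mod_cast hmn)
    rw [iUnion_ball_nat, hμ] at hlim
    exact hC (top_le_iff.1 (le_of_tendsto' hlim h))
  obtain ⟨D, hD⟩ := hK.subset_closedBall (0 : E)
  refine ⟨N + D, fun x hx s hs => ?_⟩
  by_contra! hlt
  refine absurd (hN.trans_le (measure_mono (ball_subset_ball' ?_))) (not_lt.2 hs)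
  have := mem_closedBall'.1 (hD hx)
  linarith

/-! ### Differentiation and the global level-set inequality -/

section AlmostEverywhere

variable {E : Type*} [NormedAddCommGroup E] [NormedSpace ℝ E] [FiniteDimensional ℝ E]
  [MeasurableSpace E] [BorelSpace E]

/-- Besicovitch differentiation makes small closed balls have average above `t`; null spheres pass
to open balls. -/
theorem ae_exists_ball_mul_le {μ : Measure E} [IsLocallyFiniteMeasure μ] {F : E → ℝ≥0∞}
    (hF : Measurable F) [IsLocallyFiniteMeasure (μ.withDensity F)]
    (hμ : ∀ᵐ x ∂μ, ∀ r > 0, μ (sphere x r) = 0) (t : ℝ≥0∞) :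
    ∀ᵐ x ∂μ, t < F x → ∃ s > 0, t * μ (ball x s) ≤ μ.withDensity F (ball x s) := by
  have : ProperSpace E := FiniteDimensional.proper_real E
  filter_upwards [(Besicovitch.vitaliFamily μ).ae_tendsto_rnDeriv (μ.withDensity F),
    Measure.rnDeriv_withDensity μ hF, hμ] with x hx hxF hxs htx
  rw [hxF] at hx
  obtain ⟨s, hs, hs0⟩ := (((hx.comp (Besicovitch.tendsto_filterAt μ x)).eventually
    (lt_mem_nhds htx)).and self_mem_nhdsWithin).exists
  refine ⟨s, hs0, ?_⟩
  have h1 := hxs s hs0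
  rw [← measure_closedBall_eq_measure_ball h1, ← measure_closedBall_eq_measure_ball
    (withDensity_absolutelyContinuous μ F h1)]
  exact ENNReal.mul_le_of_le_div (le_of_lt hs)

theorem ae_le_openMaximal_of_lt {μ : Measure E} [IsLocallyFiniteMeasure μ] {F : E → ℝ≥0∞}
    (hF : Measurable F) [IsLocallyFiniteMeasure (μ.withDensity F)]
    (hμ : ∀ᵐ x ∂μ, ∀ r > 0, μ (sphere x r) = 0) (t : ℝ≥0∞) :
    ∀ᵐ x ∂μ, t < F x → t ≤ openMaximal μ (μ.withDensity F) x := by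
  have : ProperSpace E := FiniteDimensional.proper_real E
  have hsupp : ∀ᵐ x ∂μ, x ∈ μ.support := Measure.measure_compl_support
  filter_upwards [ae_exists_ball_mul_le hF hμ t, hμ, hsupp] with x hx hxs hxm ht
  obtain ⟨s, hs, h⟩ := hx ht
  exact le_openMaximal hs (mem_ball_self hs)
    ((Measure.mem_support_iff_forall _).1 hxm _ (ball_mem_nhds _ hs)) measure_ball_lt_top.ne
    (hxs s hs) h

theorem ae_le_openMaximal {μ : Measure E} [IsLocallyFiniteMeasure μ] {F : E → ℝ≥0∞}
    (hF : Measurable F) [IsLocallyFiniteMeasure (μ.withDensity F)]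
    (hμ : ∀ᵐ x ∂μ, ∀ r > 0, μ (sphere x r) = 0) :
    ∀ᵐ x ∂μ, F x ≤ openMaximal μ (μ.withDensity F) x := by
  obtain ⟨D, hDc, hD⟩ := TopologicalSpace.exists_countable_dense ℝ≥0∞
  have hall : ∀ᵐ x ∂μ, ∀ t ∈ D, t < F x → t ≤ openMaximal μ (μ.withDensity F) x :=
    (ae_ball_iff hDc).2 fun t _ => ae_le_openMaximal_of_lt hF hμ t
  filter_upwards [hall] with x hx
  by_contra! hlt
  obtain ⟨t, htD, ht1, ht2⟩ := hD.exists_between hlt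
  exact absurd (hx t htD ht2) (not_le.2 ht1)

/-- The excess of `φ` over the level `t` is controlled by the set where the maximal function
exceeds `t` and `φ` does not. -/
theorem lintegral_sub_le_strictHadwigerNumber_mul [Nontrivial E] {μ : Measure E}
    [IsLocallyFiniteMeasure μ] (hinf : μ univ = ∞)
    (hμ : ∀ᵐ x ∂μ, ∀ r > 0, μ (sphere x r) = 0) {φ : E → ℝ} (hφ : 0 ≤ φ) (hφm : Measurable φ)
    [IsLocallyFiniteMeasure (μ.withDensity fun x => ENNReal.ofReal (φ x))]
    {p : ℝ} (hp : 1 < p) (hint : ∫⁻ x, ENNReal.ofReal (φ x ^ p) ∂μ ≠ ∞) {t : ℝ} (ht : 0 < t) :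
    ∫⁻ x, (ENNReal.ofReal (φ x) - ENNReal.ofReal t) ∂μ ≤
      ENNReal.ofReal t * ((strictHadwigerNumber E : ℝ≥0∞) *
        μ {x | ENNReal.ofReal (φ x) < ENNReal.ofReal t ∧ ENNReal.ofReal t ≤
          openMaximal μ (μ.withDensity fun x => ENNReal.ofReal (φ x)) x}) := by
  have : ProperSpace E := FiniteDimensional.proper_real E
  set F : E → ℝ≥0∞ := fun x => ENNReal.ofReal (φ x)
  set T := ENNReal.ofReal t
  set ρ := μ.withDensity F
  have hF : Measurable F := hφm.ennreal_ofReal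
  have hsupp : ∀ᵐ x ∂μ, x ∈ μ.support := Measure.measure_compl_support
  have hgood : ∀ᵐ x ∂μ, x ∈ μ.support ∧ (∀ r > 0, μ (sphere x r) = 0) ∧
      (T < F x → ∃ s > 0, T * μ (ball x s) ≤ ρ (ball x s)) := by
    filter_upwards [hsupp, hμ, ae_exists_ball_mul_le hF hμ T] with x h1 h2 h3 using ⟨h1, h2, h3⟩
  -- Removing a measurable null set makes every remaining point good, as the covering argument
  -- requires.
  obtain ⟨G, hGsub, hGm, hG⟩ := exists_measurable_superset_of_null (ae_iff.1 hgood)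
  set ν := μ.withDensity (fun x => F x - T)
  have hνm : Measurable fun x => F x - T := hF.sub_const T
  have hνρ : ν ≤ ρ := withDensity_mono (Eventually.of_forall fun x => tsub_le_self)
  have : IsLocallyFiniteMeasure ν := Measure.isLocallyFiniteMeasure_of_le hνρ
  set S := {x | T < F x} \ G
  have hS : MeasurableSet S := (measurableSet_lt measurable_const hF).diff hGm
  have hνS : ν univ ≤ ν S := by
    have hcov : (univ : Set E) ⊆ S ∪ ({x | F x ≤ T} ∪ G) := by
      intro x _
      by_cases h1 : x ∈ G
      · exact Or.inr (Or.inr h1)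
      · rcases le_or_gt (F x) T with h | h
        · exact Or.inr (Or.inl h)
        · exact Or.inl ⟨h, h1⟩
    have hz : ν {x | F x ≤ T} = 0 := by
      have hm : MeasurableSet {x | F x ≤ T} := measurableSet_le hF measurable_const
      rw [withDensity_apply _ hm, setLIntegral_congr_fun hm (g := fun _ => 0)
        fun x hx => tsub_eq_zero_of_le hx, lintegral_zero]
    have hz' : ν G = 0 := withDensity_absolutelyContinuous μ _ hG
    calc ν univ ≤ ν (S ∪ ({x | F x ≤ T} ∪ G)) := measure_mono hcov
      _ ≤ ν S + (ν {x | F x ≤ T} + ν G) :=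
        (measure_union_le _ _).trans (by gcongr; exact measure_union_le _ _)
      _ = ν S := by rw [hz, hz', add_zero, add_zero]
  rw [← setLIntegral_univ, ← withDensity_apply _ MeasurableSet.univ]
  refine hνS.trans ?_
  -- Inner regularity of `ν` allows compact `K`: the radius bound depends on `K`, the final estimate
  -- does not.
  rw [hS.measure_eq_iSup_isCompact]
  refine iSup_le fun K => iSup_le fun hKS => iSup_le fun hK => ?_
  rw [withDensity_apply _ hK.measurableSet]
  have hKgood : ∀ x ∈ K, x ∈ μ.support ∧ (∀ r > 0, μ (sphere x r) = 0) ∧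
      (T < F x → ∃ s > 0, T * μ (ball x s) ≤ ρ (ball x s)) := by
    intro x hx
    by_contra h
    exact (hKS hx).2 (hGsub h)
  obtain ⟨C, hC, hCs⟩ := exists_measure_bound hφ hp hint ht
  obtain ⟨R, hR⟩ := exists_radius_bound hinf hC hK.isBounded
  exact setLIntegral_sub_le_strictHadwigerNumber_mul hF hK (fun x hx => (hKgood x hx).1)
    (fun x hx => (hKgood x hx).2.1) ENNReal.ofReal_ne_top
    (fun x hx => (hKgood x hx).2.2 (hKS hx).1)
    fun x hx s _ h => hR x hx s (hCs _ measurableSet_ball measure_ball_lt_top.ne h)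

end AlmostEverywhere

/-! ### Integration over the levels -/

/-- On `(0, a]` the integral is `a ^ p / (p - 1) - a ^ p / p`. -/
theorem ofReal_rpow_div_le_lintegral {a p : ℝ} (ha : 0 ≤ a) (hp : 1 < p) :
    ENNReal.ofReal (1 / (p * (p - 1))) * ENNReal.ofReal (a ^ p) ≤
      ∫⁻ t in Ioi (0 : ℝ),
        ENNReal.ofReal (t ^ (p - 2)) * (ENNReal.ofReal a - ENNReal.ofReal t) := by
  have hp1 : 0 < p - 1 := by linarith
  have hp0 : 0 < p := by linarith
  have hi1 : IntervalIntegrable (fun t : ℝ => a * t ^ (p - 2)) volume 0 a :=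
    (intervalIntegral.intervalIntegrable_rpow' (by linarith)).const_mul a
  have hi2 : IntervalIntegrable (fun t : ℝ => t ^ (p - 1)) volume 0 a :=
    intervalIntegral.intervalIntegrable_rpow' (by linarith)
  have hval : ∫ t in (0 : ℝ)..a, (a * t ^ (p - 2) - t ^ (p - 1)) = 1 / (p * (p - 1)) * a ^ p := by
    rw [intervalIntegral.integral_sub hi1 hi2, intervalIntegral.integral_const_mul,
      integral_rpow (Or.inl (by linarith)), integral_rpow (Or.inl (by linarith))]
    have e1 : p - 2 + 1 = p - 1 := by ring
    have e2 : p - 1 + 1 = p := by ring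
    rw [e1, e2, Real.zero_rpow hp1.ne', Real.zero_rpow hp0.ne', sub_zero, sub_zero]
    have e3 : a * (a ^ (p - 1) / (p - 1)) = a ^ p / (p - 1) := by
      rcases ha.eq_or_lt with h | h
      · rw [← h, Real.zero_rpow hp0.ne']; simp
      · rw [← mul_div_assoc, mul_comm, Real.rpow_sub_one h.ne', div_mul_cancel₀ _ h.ne']
    rw [e3]
    field_simp
    ring
  have heq : ∀ t ∈ Ioc 0 a, ENNReal.ofReal (a * t ^ (p - 2) - t ^ (p - 1)) =
      ENNReal.ofReal (t ^ (p - 2)) * (ENNReal.ofReal a - ENNReal.ofReal t) := by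
    intro t ht
    rw [← ENNReal.ofReal_sub _ ht.1.le, ← ENNReal.ofReal_mul (Real.rpow_nonneg ht.1.le _)]
    congr 1
    have : t ^ (p - 1) = t ^ (p - 2) * t := by
      rw [← Real.rpow_add_one ht.1.ne']
      congr 1
      ring
    rw [this]
    ring
  rw [← ENNReal.ofReal_mul (by positivity), ← hval, intervalIntegral.integral_of_le ha,
    ofReal_integral_eq_lintegral_ofReal ((intervalIntegrable_iff_integrableOn_Ioc_of_le ha).1
      (hi1.sub hi2)), setLIntegral_congr_fun measurableSet_Ioc heq]
  · exact lintegral_mono_set Ioc_subset_Ioi_self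
  · refine (ae_restrict_iff' measurableSet_Ioc).2 (Eventually.of_forall fun t ht => ?_)
    have : t ^ (p - 1) = t * t ^ (p - 2) := by
      rw [mul_comm, ← Real.rpow_add_one ht.1.ne']
      congr 1
      ring
    simp only [Pi.zero_apply]
    rw [this, sub_nonneg]
    exact mul_le_mul_of_nonneg_right ht.2 (Real.rpow_nonneg ht.1.le _)

section LayerCake

variable {X : Type*} [MeasurableSpace X]

theorem ofReal_mul_lintegral_rpow_le {μ : Measure X} [SFinite μ] {φ : X → ℝ} (hφ : 0 ≤ φ)
    (hφm : Measurable φ) {p : ℝ} (hp : 1 < p) :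
    ENNReal.ofReal (1 / (p * (p - 1))) * ∫⁻ x, ENNReal.ofReal (φ x ^ p) ∂μ ≤
      ∫⁻ t in Ioi (0 : ℝ), ENNReal.ofReal (t ^ (p - 2)) *
        ∫⁻ x, (ENNReal.ofReal (φ x) - ENNReal.ofReal t) ∂μ := by
  calc _ = ∫⁻ x, ENNReal.ofReal (1 / (p * (p - 1))) * ENNReal.ofReal (φ x ^ p) ∂μ :=
        (lintegral_const_mul' _ _ ENNReal.ofReal_ne_top).symm
    _ ≤ ∫⁻ x, (∫⁻ t in Ioi (0 : ℝ), ENNReal.ofReal (t ^ (p - 2)) *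
          (ENNReal.ofReal (φ x) - ENNReal.ofReal t)) ∂μ :=
        lintegral_mono fun x => ofReal_rpow_div_le_lintegral (hφ x) hp
    _ = ∫⁻ t in Ioi (0 : ℝ), (∫⁻ x, ENNReal.ofReal (t ^ (p - 2)) *
          (ENNReal.ofReal (φ x) - ENNReal.ofReal t) ∂μ) := by
        refine lintegral_lintegral_swap (Measurable.aemeasurable ?_)
        unfold Function.uncurry
        fun_prop
    _ = _ := by
        refine lintegral_congr fun t => ?_
        exact lintegral_const_mul' _ _ ENNReal.ofReal_ne_top

/-- Integrating the level-set inequality against `t ^ (p - 2)`. -/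
theorem lintegral_rpow_add_le {μ : Measure X} [SFinite μ] {φ ψ : X → ℝ} (hφ : 0 ≤ φ)
    (hφm : Measurable φ) (hψm : Measurable ψ) (hφψ : φ ≤ᵐ[μ] ψ) {L : ℝ≥0∞} {p : ℝ} (hp : 1 < p)
    (h : ∀ t > 0, ∫⁻ x, (ENNReal.ofReal (φ x) - ENNReal.ofReal t) ∂μ ≤
      ENNReal.ofReal t * (L * μ {x | φ x < t ∧ t ≤ ψ x})) :
    ENNReal.ofReal (1 / (p - 1)) * ∫⁻ x, ENNReal.ofReal (φ x ^ p) ∂μ +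
      L * ∫⁻ x, ENNReal.ofReal (φ x ^ p) ∂μ ≤ L * ∫⁻ x, ENNReal.ofReal (ψ x ^ p) ∂μ := by
  have hp1 : 0 < p - 1 := by linarith
  have hp0 : 0 < p := by linarith
  have hψ : 0 ≤ᵐ[μ] ψ := hφψ.mono fun x hx => (hφ x).trans hx
  have hmeas : ∀ χ : X → ℝ,
      Measurable fun t : ℝ => μ {x | t ≤ χ x} * ENNReal.ofReal (t ^ (p - 1)) := by
    intro χ
    have h1 : Antitone fun t : ℝ => μ {x | t ≤ χ x} :=
      fun s t hst => measure_mono fun x (hx : t ≤ χ x) => hst.trans hx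
    exact h1.measurable.mul (by fun_prop)
  have hlevel : ∀ t > 0, μ {x | φ x < t ∧ t ≤ ψ x} + μ {x | t ≤ φ x} ≤ μ {x | t ≤ ψ x} := by
    intro t _
    rw [← measure_union _ (measurableSet_le measurable_const hφm)]
    · refine measure_mono_ae ?_
      filter_upwards [hφψ] with x hx hxt
      rcases hxt with h | h
      · exact h.2
      · exact le_trans h hx
    · exact disjoint_left.2 fun x h1 h2 => absurd h2 (not_le.2 h1.1)
  have hpt : ∀ t ∈ Ioi (0 : ℝ),
      ENNReal.ofReal (t ^ (p - 2)) * ∫⁻ x, (ENNReal.ofReal (φ x) - ENNReal.ofReal t) ∂μ +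
        L * (μ {x | t ≤ φ x} * ENNReal.ofReal (t ^ (p - 1))) ≤
      L * (μ {x | t ≤ ψ x} * ENNReal.ofReal (t ^ (p - 1))) := by
    intro t ht
    have ht0 : 0 < t := ht
    have e : ENNReal.ofReal (t ^ (p - 2)) * ENNReal.ofReal t = ENNReal.ofReal (t ^ (p - 1)) := by
      rw [← ENNReal.ofReal_mul (Real.rpow_nonneg ht0.le _), ← Real.rpow_add_one ht0.ne']
      congr 2
      ring
    calc _ ≤ ENNReal.ofReal (t ^ (p - 2)) *
            (ENNReal.ofReal t * (L * μ {x | φ x < t ∧ t ≤ ψ x})) +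
          L * (μ {x | t ≤ φ x} * ENNReal.ofReal (t ^ (p - 1))) := by gcongr; exact h t ht0
      _ = L * ((μ {x | φ x < t ∧ t ≤ ψ x} + μ {x | t ≤ φ x}) *
          ENNReal.ofReal (t ^ (p - 1))) := by rw [← mul_assoc, e]; ring
      _ ≤ _ := by gcongr; exact hlevel t ht0
  have hint := setLIntegral_mono' (μ := volume) measurableSet_Ioi hpt
  rw [lintegral_add_right _ ((hmeas φ).const_mul L), lintegral_const_mul _ (hmeas φ),
    lintegral_const_mul _ (hmeas ψ)] at hint
  have hmain := (add_le_add_left (ofReal_mul_lintegral_rpow_le (μ := μ) hφ hφm hp) _).trans hint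
  have hX := lintegral_rpow_eq_lintegral_meas_le_mul μ (Eventually.of_forall hφ)
    hφm.aemeasurable hp0
  have hY := lintegral_rpow_eq_lintegral_meas_le_mul μ hψ hψm.aemeasurable hp0
  -- The factor `p` is the one in the layer-cake formulas `hX` and `hY`.
  have hmul := mul_le_mul_right hmain (ENNReal.ofReal p)
  rw [mul_add, ← mul_assoc (ENNReal.ofReal p), ← ENNReal.ofReal_mul hp0.le,
    mul_left_comm _ L, mul_left_comm _ L, ← hX, ← hY] at hmul
  have e : p * (1 / (p * (p - 1))) = 1 / (p - 1) := by field_simp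
  rwa [e] at hmul

end LayerCake

/-! ### Norm inequality and conclusion -/

theorem one_add_rpow_mul_le {X Y L : ℝ≥0∞} {p : ℝ} (hp : 1 < p) (hL : 1 ≤ L) (hXY : X ≤ Y)
    (h : ENNReal.ofReal (1 / (p - 1)) * X + L * X ≤ L * Y) :
    (1 + 1 / (ENNReal.ofReal (p - 1) * L)) ^ (1 / p) * X ^ (1 / p) ≤ Y ^ (1 / p) := by
  have hp1 : 0 < p - 1 := by linarith
  have hpos : 0 ≤ 1 / p := by positivity
  rw [← ENNReal.mul_rpow_of_nonneg _ _ hpos]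
  refine ENNReal.rpow_le_rpow ?_ hpos
  have hc0 : ENNReal.ofReal (p - 1) ≠ 0 := (ENNReal.ofReal_pos.2 hp1).ne'
  -- For `L = ∞` the constant is `1`, and `X ≤ Y` suffices.
  rcases eq_or_ne L ∞ with rfl | hLtop
  · rw [ENNReal.mul_top hc0]
    simpa using hXY
  · have hL0 : L ≠ 0 := (zero_lt_one.trans_le hL).ne'
    have h1 := mul_le_mul_right h L⁻¹
    rw [mul_add, ← mul_assoc L⁻¹ L, ← mul_assoc L⁻¹ L, ENNReal.inv_mul_cancel hL0 hLtop, one_mul,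
      one_mul] at h1
    refine le_trans (le_of_eq ?_) h1
    rw [add_mul, one_mul, add_comm, one_div, one_div,
      ENNReal.mul_inv (Or.inl hc0) (Or.inl ENNReal.ofReal_ne_top), ENNReal.ofReal_inv_of_pos hp1]
    ring

theorem isLocallyFiniteMeasure_withDensity_ofReal {X : Type*} [TopologicalSpace X]
    [WeaklyLocallyCompactSpace X] [T2Space X] [MeasurableSpace X] [OpensMeasurableSpace X]
    {μ : Measure X} [IsFiniteMeasureOnCompacts μ] {φ : X → ℝ} (hφ : 0 ≤ φ) {p : ℝ} (hp : 1 < p)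
    (hint : ∫⁻ x, ENNReal.ofReal (φ x ^ p) ∂μ ≠ ∞) :
    IsLocallyFiniteMeasure (μ.withDensity fun x => ENNReal.ofReal (φ x)) := by
  obtain ⟨C, hC, h⟩ := exists_withDensity_le hφ hp hint zero_lt_two
  have : IsFiniteMeasureOnCompacts (μ.withDensity fun x => ENNReal.ofReal (φ x)) :=
    ⟨fun K hK => (h K hK.measurableSet).trans_lt (ENNReal.add_lt_top.2
      ⟨ENNReal.mul_lt_top ENNReal.ofReal_lt_top hK.measure_lt_top, hC.lt_top⟩)⟩
  exact isLocallyFiniteMeasure_of_isFiniteMeasureOnCompacts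

/-- The lower bound for the maximal function over open balls with null sphere. -/
theorem one_add_rpow_mul_le_lintegral_openMaximal {E : Type*} [NormedAddCommGroup E]
    [NormedSpace ℝ E] [FiniteDimensional ℝ E] [Nontrivial E] [MeasurableSpace E] [BorelSpace E]
    {μ : Measure E} [IsFiniteMeasureOnCompacts μ] (hinf : μ univ = ∞)
    (hμ : ∀ᵐ x ∂μ, ∀ r > 0, μ (sphere x r) = 0) {φ : E → ℝ} (hφ : 0 ≤ φ) (hφm : Measurable φ)
    {p : ℝ} (hp : 1 < p) (hint : ∫⁻ x, ENNReal.ofReal (φ x ^ p) ∂μ ≠ ∞) :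
    (1 + 1 / (ENNReal.ofReal (p - 1) * (strictHadwigerNumber E : ℝ≥0∞))) ^ (1 / p) *
        (∫⁻ x, ENNReal.ofReal (φ x ^ p) ∂μ) ^ (1 / p) ≤
      (∫⁻ x, openMaximal μ (μ.withDensity fun x => ENNReal.ofReal (φ x)) x ^ p ∂μ) ^ (1 / p) := by
  have : ProperSpace E := FiniteDimensional.proper_real E
  have hp0 : 0 < p := by linarith
  have : IsLocallyFiniteMeasure μ := isLocallyFiniteMeasure_of_isFiniteMeasureOnCompacts
  have : IsLocallyFiniteMeasure (μ.withDensity fun x => ENNReal.ofReal (φ x)) :=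
    isLocallyFiniteMeasure_withDensity_ofReal hφ hp hint
  have hF := hφm.ennreal_ofReal
  have hle := ae_le_openMaximal hF hμ
  set g := openMaximal μ (μ.withDensity fun x => ENNReal.ofReal (φ x))
  have hg : Measurable g := measurable_openMaximal _ _
  -- Once the integral is finite, `g` is finite almost everywhere and can be made real-valued.
  rcases eq_or_ne (∫⁻ x, g x ^ p ∂μ) ∞ with hY | hY
  · rw [hY, ENNReal.top_rpow_of_pos (by positivity)]
    exact le_top
  have hgfin : ∀ᵐ x ∂μ, g x ≠ ∞ := by
    filter_upwards [ae_lt_top (hg.pow_const p) hY] with x hx htop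
    rw [htop, ENNReal.top_rpow_of_pos hp0] at hx
    exact lt_irrefl _ hx
  have hφψ : φ ≤ᵐ[μ] fun x => (g x).toReal := by
    filter_upwards [hle, hgfin] with x h1 h2
    exact (ENNReal.ofReal_le_iff_le_toReal h2).1 h1
  have hgY : ∫⁻ x, g x ^ p ∂μ = ∫⁻ x, ENNReal.ofReal ((g x).toReal ^ p) ∂μ := by
    refine lintegral_congr_ae ?_
    filter_upwards [hgfin] with x hx
    rw [← ENNReal.ofReal_rpow_of_nonneg ENNReal.toReal_nonneg hp0.le, ENNReal.ofReal_toReal hx]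
  rw [hgY]
  refine one_add_rpow_mul_le hp ?_ ?_ (lintegral_rpow_add_le hφ hφm hg.ennreal_toReal hφψ hp ?_)
  · exact_mod_cast ENat.toENNReal_le.2 (one_le_strictHadwigerNumber (E := E))
  · refine lintegral_mono_ae ?_
    filter_upwards [hφψ] with x hx
    exact ENNReal.ofReal_le_ofReal (Real.rpow_le_rpow (hφ x) hx hp0.le)
  · intro t ht
    refine (lintegral_sub_le_strictHadwigerNumber_mul hinf hμ hφ hφm hp hint ht).trans ?_
    refine mul_le_mul_right (mul_le_mul_right (measure_mono_ae ?_) _) _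
    filter_upwards [hgfin] with x hx hxt
    exact ⟨(ENNReal.ofReal_lt_ofReal_iff ht).1 hxt.1,
      (ENNReal.ofReal_le_iff_le_toReal hx).1 hxt.2⟩

theorem corollary1p2 {E : Type*} [NormedAddCommGroup E] [NormedSpace ℝ E] [FiniteDimensional ℝ E]
    [MeasurableSpace E] [BorelSpace E]
    (B : E → ℝ → Set E) (hB : B = Metric.ball ∨ B = Metric.closedBall)
    (μ : Measure E) [μ.Regular] (hμ : μ Set.univ = ∞)
    (hcont : μ {x ∈ μ.support | ¬ ContinuousOn (fun r : ℝ => μ (B x r)) (Set.Ioi 0)} = 0)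
    (p : ℝ) (hp : 1 < p) (f : E → ℝ) (hf : MemLp f (ENNReal.ofReal p) μ) :
    (1 + 1 / (ENNReal.ofReal (p - 1) * (strictHadwigerNumber E : ℝ≥0∞))) ^ (1 / p) *
        eLpNorm f (ENNReal.ofReal p) μ ≤
      eLpNorm (uncenteredMaximal B μ f) (ENNReal.ofReal p) μ := by
  have : ProperSpace E := FiniteDimensional.proper_real E
  have hp0 : 0 < p := by linarith
  have hpE0 : ENNReal.ofReal p ≠ 0 := (ENNReal.ofReal_pos.2 hp0).ne'
  -- In dimension `0` the space is a compact point, which cannot carry infinite measure.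
  have hnt : Nontrivial E := by
    by_contra h
    have : Subsingleton E := not_nontrivial_iff_subsingleton.1 h
    exact (Set.subsingleton_univ.finite.isCompact.measure_lt_top (μ := μ)).ne hμ
  have hsph : ∀ᵐ x ∂μ, ∀ r > 0, μ (sphere x r) = 0 := by
    have hsupp : ∀ᵐ x ∂μ, x ∈ μ.support := Measure.measure_compl_support
    have hc : ∀ᵐ x ∂μ,
        ¬ (x ∈ μ.support ∧ ¬ ContinuousOn (fun r : ℝ => μ (B x r)) (Set.Ioi 0)) :=
      measure_eq_zero_iff_ae_notMem.1 hcont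
    filter_upwards [hsupp, hc] with x h1 h2 r hr
    exact measure_sphere_eq_zero_of_continuousOn hB (not_not.1 fun h => h2 ⟨h1, h⟩) hr
  set f' := hf.1.mk f
  have hff' : f =ᵐ[μ] f' := hf.1.ae_eq_mk
  have hf'm : Measurable f' := hf.1.stronglyMeasurable_mk.measurable
  set φ : E → ℝ := fun x => ‖f' x‖
  have hφ : 0 ≤ φ := fun x => norm_nonneg _
  have hφf : (fun x => ‖f x‖ₑ) =ᵐ[μ] fun x => ENNReal.ofReal (φ x) := by
    filter_upwards [hff'] with x hx
    rw [hx, ofReal_norm]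
  have hX : ∫⁻ x, ‖f x‖ₑ ^ p ∂μ = ∫⁻ x, ENNReal.ofReal (φ x ^ p) ∂μ := by
    refine lintegral_congr_ae ?_
    filter_upwards [hφf] with x hx
    rw [hx, ENNReal.ofReal_rpow_of_nonneg (hφ x) hp0.le]
  have hint : ∫⁻ x, ENNReal.ofReal (φ x ^ p) ∂μ ≠ ∞ := by
    have := (lintegral_rpow_enorm_lt_top_of_eLpNorm_lt_top hpE0 ENNReal.ofReal_ne_top hf.2).ne
    rwa [ENNReal.toReal_ofReal hp0.le, hX] at this
  rw [eLpNorm_eq_lintegral_rpow_enorm_toReal hpE0 ENNReal.ofReal_ne_top,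
    eLpNorm_eq_lintegral_rpow_enorm_toReal hpE0 ENNReal.ofReal_ne_top,
    ENNReal.toReal_ofReal hp0.le, hX]
  refine (one_add_rpow_mul_le_lintegral_openMaximal hμ hsph hφ hf'm.norm hp hint).trans ?_
  gcongr with x
  rw [← withDensity_congr_ae hφf, enorm_eq_self]
  exact openMaximal_le_uncenteredMaximal hB μ f x
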